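/- Let $K$ be a field of characteristic zero, let $f,g\in K[z]$ be nonzero polynomials of degrees $n=\deg f$ and $m_0=\deg g$, and put $d_0=\gcd(n,m_0)$. Let $K[f,g]$ denote the $K$-subalgebra of $K[z]$ generated by $f$ and $g$. If $K[f,g]$ contains an element $h$ with $\deg h=d_0$, then $m_0\mid n$ or $n\mid m_0$; in other words, when $n$ and $m_0$ are positive, $n/m_0$ or $m_0/n$ is an integer. -/

import Mathlib

open Polynomial WithZero

/-! ### Adic expansions and approximate roots. -/

section AdicExpansion

variable {S : Type*} [CommRing S]

/-! It suffices to find `i, j ≥ 0` with `i * n + j * m₀ = gcd n m₀`: if `i > 0` then `n ≤ gcd n m₀`,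
so `n ∣ m₀`; if `i = 0` then `m₀` divides the gcd, hence `n`.

Send `x ↦ f`, `X ↦ g`, and measure elements of `K(z)` by the valuation `exp (deg)`. An element of
`K[f,g]` comes from some `H ∈ K[x][X]`. If `H` had `X`-degree below `n / gcd n m₀`, its nonzero
terms `a(x) X^j` would have distinct degrees, and the dominant one would give `i = deg a` and `j`.
So `H` must be replaced by a polynomial of small `X`-degree and the same value, with coefficients
still in `K[x]` and not merely in `K(x)`.

This is `IsStage.exists_lift`, a descending induction along key polynomials (monic, of least value
in their degree) that starts at the minimal polynomial of `g`, which has coefficients in `K[x]`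
because `g` is integral over `K[f]`. In one descent, a polynomial `T` over `K[x]` of degree `k * (e
+ 1)` and small value is given. Its approximate `(e + 1)`-th root exists over `K[x]`, as `e + 1` is
invertible, and has least value in degree `k` (`exists_approxRoot_map_eq`). Expanding in powers of
this root then lets all but the constant coefficient be dropped. -/

theorem Polynomial.degree_mul_lt_of_lt_of_natDegree_le {P Q : S[X]} {a b : ℕ}
    (hP : P.degree < a) (hQ : Q.natDegree ≤ b) : (P * Q).degree < (a + b : ℕ) := by
  calc (P * Q).degree ≤ P.degree + Q.degree := degree_mul_le _ _
    _ ≤ P.degree + (b : WithBot ℕ) := by gcongr; exact natDegree_le_iff_degree_le.1 hQ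
    _ < (a : WithBot ℕ) + (b : WithBot ℕ) := WithBot.add_lt_add_right (by simp) hP
    _ = (a + b : ℕ) := by push_cast; rfl

theorem Polynomial.degree_sum_mul_pow_lt {G : S[X]} {k e : ℕ} {A : ℕ → S[X]}
    (hG : G.natDegree = k) (hA : ∀ j, (A j).degree < k) :
    (∑ j ∈ Finset.range e, A j * G ^ j).degree < (k * e : ℕ) := by
  rw [← mem_degreeLT]
  refine Submodule.sum_mem _ fun j hj => ?_
  rw [mem_degreeLT]
  have h := degree_mul_lt_of_lt_of_natDegree_le (hA j)
    (natDegree_pow_le_of_le j (le_of_eq hG))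
  refine h.trans_le ?_
  have : j + 1 ≤ e := Finset.mem_range.1 hj
  exact_mod_cast (by nlinarith : k + j * k ≤ k * e)

theorem Polynomial.Monic.exists_adic_expansion [Nontrivial S] {G : S[X]} {k : ℕ} (hG : G.Monic)
    (hk : G.natDegree = k) (e : ℕ) :
    ∀ Q : S[X], Q.degree < (k * e : ℕ) →
      ∃ A : ℕ → S[X], (∀ j, (A j).degree < k) ∧ Q = ∑ j ∈ Finset.range e, A j * G ^ j := by
  induction e with
  | zero =>
    intro Q hQ
    refine ⟨0, fun j => by simp, ?_⟩
    have : Q = 0 := by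
      rw [← degree_eq_bot]
      simpa using hQ
    simpa using this
  | succ e ih =>
    intro Q hQ
    have hGd : G.degree = k := by rw [degree_eq_natDegree hG.ne_zero, hk]
    obtain ⟨A, hA, hQA⟩ := ih (Q /ₘ G) (by
      rcases eq_or_ne (Q /ₘ G) 0 with h0 | h0
      · rw [h0, degree_zero]; exact WithBot.bot_lt_coe _
      have h1 : G.degree ≤ Q.degree := by
        by_contra h
        exact h0 ((divByMonic_eq_zero_iff hG).2 (not_le.1 h))
      have h2 := degree_add_divByMonic hG h1
      rw [← h2, hGd, degree_eq_natDegree h0] at hQ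
      rw [degree_eq_natDegree h0]
      have : k + (Q /ₘ G).natDegree < k * (e + 1) := by exact_mod_cast hQ
      exact_mod_cast (by nlinarith : (Q /ₘ G).natDegree < k * e))
    refine ⟨fun j => Nat.casesOn j (Q %ₘ G) A, ?_, ?_⟩
    · rintro (_ | j)
      · exact hGd ▸ degree_modByMonic_lt _ hG
      · exact hA j
    · rw [Finset.sum_range_succ']
      simp only [pow_zero, mul_one, pow_succ, ← mul_assoc]
      rw [← Finset.sum_mul, ← hQA, add_comm, mul_comm]
      exact (modByMonic_add_div Q G).symm

/-- First-order binomial expansion: the remaining terms contain `B ^ 2`, and trading a factor `G`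
for `B` costs degree because `s < k`. -/
theorem Polynomial.degree_add_pow_sub_lt {G B : S[X]} {k s : ℕ} (hG : G.natDegree ≤ k)
    (hB : B.natDegree ≤ s) (hs : s < k) (e : ℕ) :
    ((G + B) ^ (e + 1) - G ^ (e + 1) - (e + 1 : S[X]) * B * G ^ e).degree < (k * e + s : ℕ) := by
  induction e with
  | zero => simp
  | succ e ih =>
    have key : (G + B) ^ (e + 1 + 1) - G ^ (e + 1 + 1) - ((e + 1 : ℕ) + 1 : S[X]) * B * G ^ (e + 1)
        = ((G + B) ^ (e + 1) - G ^ (e + 1) - (e + 1 : S[X]) * B * G ^ e) * (G + B)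
          + (e + 1 : S[X]) * B ^ 2 * G ^ e := by
      push_cast; ring
    rw [key]
    refine (degree_add_le _ _).trans_lt (max_lt ?_ ?_)
    · have h := degree_mul_lt_of_lt_of_natDegree_le ih
        ((natDegree_add_le G B).trans (max_le hG (hB.trans hs.le)))
      convert h using 2
      ring
    · have h1 : ((e + 1 : S[X]) * B ^ 2 * G ^ e).natDegree ≤ 0 + 2 * s + e * k := by
        refine natDegree_mul_le_of_le (natDegree_mul_le_of_le ?_ (natDegree_pow_le_of_le 2 hB))
          (natDegree_pow_le_of_le e hG)
        exact_mod_cast (natDegree_natCast (R := S) (e + 1)).le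
      refine (natDegree_le_iff_degree_le.1 h1).trans_lt ?_
      exact_mod_cast (by nlinarith : 0 + 2 * s + e * k < k * (e + 1) + s)

/-- Tschirnhausen iteration producing an approximate `(e + 1)`-th root of `T`,
along a predicate `p` that is stable under the iteration. -/
theorem Polynomial.exists_approxRoot [Nontrivial S] {k e : ℕ} {u : S} (hu : ((e : S) + 1) * u = 1)
    {T : S[X]} (hT : T.Monic) (hTk : T.natDegree = k * (e + 1)) {p : S[X] → Prop}
    (hp : ∀ G : S[X], G.Monic → G.natDegree = k → p G → ∀ A : S[X], A.degree < k →
      (T - G ^ (e + 1) - A * G ^ e).degree < (k * e : ℕ) → p (G + C u * A))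
    {G : S[X]} (hG : G.Monic) (hGk : G.natDegree = k) (hpG : p G) :
    ∃ H : S[X], H.Monic ∧ H.natDegree = k ∧ p H ∧ (T - H ^ (e + 1)).degree < (k * e : ℕ) := by
  suffices h : ∀ s ≤ k, ∀ G : S[X], G.Monic → G.natDegree = k → p G →
      (T - G ^ (e + 1)).degree < (k * e + s : ℕ) →
      ∃ H : S[X], H.Monic ∧ H.natDegree = k ∧ p H ∧ (T - H ^ (e + 1)).degree < (k * e : ℕ) by
    refine h k le_rfl G hG hGk hpG ?_
    have h1 : (G ^ (e + 1)).natDegree = T.natDegree := by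
      rw [hG.natDegree_pow, hGk, hTk, mul_comm]
    have h2 : T.degree = (G ^ (e + 1)).degree := by
      rw [degree_eq_natDegree hT.ne_zero, degree_eq_natDegree (hG.pow _).ne_zero, h1]
    have h3 := degree_sub_lt_left h2 hT.ne_zero (by rw [hT.leadingCoeff, (hG.pow _).leadingCoeff])
    rwa [degree_eq_natDegree hT.ne_zero, hTk] at h3
  intro s
  induction s with
  | zero => exact fun _ G h1 h2 h3 h4 => ⟨G, h1, h2, h3, h4⟩
  | succ s ih =>
    intro hs G hG hGk hpG hd
    obtain ⟨A, hA, hTA⟩ := hG.exists_adic_expansion hGk (e + 1) (T - G ^ (e + 1))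
      (hd.trans_le (by exact_mod_cast (by nlinarith : k * e + (s + 1) ≤ k * (e + 1))))
    rw [Finset.sum_range_succ] at hTA
    have hrem : (T - G ^ (e + 1) - A e * G ^ e).degree < (k * e : ℕ) := by
      rw [hTA, add_sub_cancel_right]
      exact degree_sum_mul_pow_lt hGk hA
    have hAs : (A e).natDegree ≤ s := by
      by_contra! hlt
      have hne : A e ≠ 0 := by rintro h; simp [h] at hlt
      have h1 : (A e * G ^ e).degree < (k * e + (s + 1) : ℕ) := by
        have : A e * G ^ e = (T - G ^ (e + 1)) - (T - G ^ (e + 1) - A e * G ^ e) := by ring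
        rw [this]
        refine (degree_sub_le _ _).trans_lt (max_lt hd (hrem.trans_le ?_))
        exact_mod_cast Nat.le_add_right _ _
      rw [(hG.pow e).degree_mul, degree_eq_natDegree hne,
        degree_eq_natDegree (hG.pow e).ne_zero, hG.natDegree_pow, hGk] at h1
      have : (A e).natDegree + e * k < k * e + (s + 1) := by exact_mod_cast h1
      nlinarith
    have hAd : (C u * A e).degree < k := by
      rw [← smul_eq_C_mul]
      exact (degree_smul_le u (A e)).trans_lt (hA e)
    have hGd : (C u * A e).degree < G.degree := by
      rwa [degree_eq_natDegree hG.ne_zero, hGk]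
    refine ih (by omega) (G + C u * A e) (hG.add_of_left hGd)
      (by rw [natDegree_add_eq_left_of_degree_lt hGd, hGk]) (hp G hG hGk hpG _ (hA e) hrem) ?_
    -- Since `(e + 1) * u = 1`, the first-order change of `G ^ (e + 1)` is exactly `A e * G ^ e`,
    -- the term to be removed.
    have hB := degree_add_pow_sub_lt hGk.le ((natDegree_C_mul_le u (A e)).trans hAs)
      (by omega : s < k) e
    have hCu : ((e : S[X]) + 1) * C u = 1 := by
      simpa using congrArg C hu
    have heq : T - (G + C u * A e) ^ (e + 1) = (T - G ^ (e + 1) - A e * G ^ e) -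
        ((G + C u * A e) ^ (e + 1) - G ^ (e + 1) - (e + 1 : S[X]) * (C u * A e) * G ^ e) := by
      linear_combination (-A e * G ^ e) * hCu
    rw [heq]
    refine (degree_sub_le _ _).trans_lt (max_lt (hrem.trans_le ?_) hB)
    exact_mod_cast Nat.le_add_right _ _

/-- Uniqueness of approximate roots: the cofactor of `G - H` in the difference of powers has
coefficient `e + 1 ≠ 0` in degree `k * e`. -/
theorem Polynomial.Monic.eq_of_degree_pow_sub_pow_lt {F : Type*} [Field F] [CharZero F] {G H : F[X]}
    {k e : ℕ} (hG : G.Monic) (hH : H.Monic) (hGk : G.natDegree = k) (hHk : H.natDegree = k)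
    (h : (G ^ (e + 1) - H ^ (e + 1)).degree < (k * e : ℕ)) : G = H := by
  by_contra hne
  have hne' : G - H ≠ 0 := sub_ne_zero.2 hne
  rw [← (Commute.all G H).geom_sum₂_mul] at h
  set Q := ∑ i ∈ Finset.range (e + 1), G ^ i * H ^ (e + 1 - 1 - i) with hQ
  have hc : Q.coeff (k * e) = (e + 1 : F) := by
    rw [hQ, finsetSum_coeff]
    rw [Finset.sum_congr rfl (g := fun _ => (1 : F))]
    · simp
    · intro i hi
      have hi' : i ≤ e := by simpa [Nat.lt_succ_iff] using hi
      have hm : (G ^ i * H ^ (e + 1 - 1 - i)).Monic := (hG.pow _).mul (hH.pow _)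
      have hd : (G ^ i * H ^ (e + 1 - 1 - i)).natDegree = k * e := by
        rw [(hG.pow _).natDegree_mul (hH.pow _), hG.natDegree_pow, hH.natDegree_pow, hGk, hHk,
          ← add_mul, mul_comm]
        congr 1
        omega
      rw [← hd]
      exact hm
  have hle : ((k * e : ℕ) : WithBot ℕ) ≤ Q.degree :=
    le_degree_of_ne_zero (by rw [hc]; exact_mod_cast Nat.succ_ne_zero e)
  rw [Polynomial.degree_mul, degree_eq_natDegree hne'] at h
  refine absurd h (not_lt.2 (hle.trans ?_))
  exact le_add_of_nonneg_right (by exact_mod_cast Nat.zero_le _)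

end AdicExpansion

/-! ### Sums of terms with distinct values. -/

section Valuation

variable {E : Type*} [Field E] {Γ : Type*} [LinearOrderedCommGroupWithZero Γ] (v : Valuation E Γ)

theorem Valuation.exists_map_sum_eq_of_injOn {ι : Type*} {s : Finset ι} {x : ι → E}
    (hinj : ∀ i ∈ s, ∀ j ∈ s, x i ≠ 0 → x j ≠ 0 → v (x i) = v (x j) → i = j)
    (hne : ∃ i ∈ s, x i ≠ 0) :
    ∃ j ∈ s, x j ≠ 0 ∧ v (∑ i ∈ s, x i) = v (x j) ∧ ∀ i ∈ s, v (x i) ≤ v (∑ i ∈ s, x i) := by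
  classical
  obtain ⟨i₀, hi₀, hx₀⟩ := hne
  obtain ⟨j, hj, hmax⟩ := s.exists_max_image (fun i => v (x i)) ⟨i₀, hi₀⟩
  have hvj : 0 < v (x j) := lt_of_lt_of_le (by simpa [zero_lt_iff] using hx₀) (hmax i₀ hi₀)
  have hxj : x j ≠ 0 := by rintro h; simp [h] at hvj
  have hsum : v (∑ i ∈ s, x i) = v (x j) := by
    rw [← Finset.add_sum_erase s x hj]
    refine v.map_add_eq_of_lt_left (v.map_sum_lt hvj.ne' fun i hi => ?_)
    obtain ⟨hij, his⟩ := Finset.mem_erase.1 hi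
    refine lt_of_le_of_ne (hmax i his) fun heq => hij ?_
    refine hinj i his j hj (fun h => ?_) hxj heq
    rw [h, map_zero] at heq
    exact hvj.ne heq
  exact ⟨j, hj, hxj, hsum, fun i hi => hsum ▸ hmax i hi⟩

end Valuation

theorem Valuation.ne_zero_of_map_eq_exp {E : Type*} [Field E] {v : Valuation E ℤᵐ⁰} {x : E}
    {t : ℤ} (h : v x = exp t) : x ≠ 0 :=
  v.ne_zero_iff.1 (h ▸ exp_ne_zero)

/-! ### Stages and key polynomials over a field. -/

section Stage

variable {F E : Type*} [Field F] [Field E]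

/-- The nonzero polynomials of degree `< k` take, through `v ∘ φ`, exactly the values `exp (d * t)`. -/
structure Polynomial.IsStage (v : Valuation E ℤᵐ⁰) (φ : F[X] →+* E) (k : ℕ) (d : ℤ) : Prop where
  exists_eq : ∀ A : F[X], A.degree < k → A ≠ 0 → ∃ t : ℤ, v (φ A) = exp (d * t)
  exists_poly : ∀ t : ℤ, ∃ A : F[X], A.degree < k ∧ v (φ A) = exp (d * t)

namespace Polynomial.IsStage

variable {v : Valuation E ℤᵐ⁰} {φ : F[X] →+* E} {k : ℕ} {d : ℤ}

theorem map_ne_zero (h : IsStage v φ k d) {A : F[X]} (hA : A.degree < k) (hA0 : A ≠ 0) :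
    φ A ≠ 0 := by
  obtain ⟨t, ht⟩ := h.exists_eq A hA hA0
  exact Valuation.ne_zero_of_map_eq_exp ht

theorem pos (h : IsStage v φ k d) : 0 < k := by
  obtain ⟨A, hA, hv⟩ := h.exists_poly 0
  rcases Nat.eq_zero_or_pos k with rfl | hk
  · have : A = 0 := by rw [← degree_eq_bot]; simpa using hA
    simp [this] at hv
  · exact hk

/-- Two nonzero terms of equal value would give `d ∣ (i - j) * m` with `|i - j| < e`. Hence the
values are distinct and no cancellation occurs in the sum. -/
theorem exists_map_sum (h : IsStage v φ k d) {G : F[X]} {m : ℤ} (hv : v (φ G) = exp m)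
    {e : ℕ} (he : ∀ j : ℤ, |j| < e → d ∣ j * m → j = 0) {A : ℕ → F[X]}
    (hA : ∀ j, (A j).degree < k) (hne : ∃ j < e, A j ≠ 0) :
    ∃ j < e, A j ≠ 0 ∧
      v (φ (∑ i ∈ Finset.range e, A i * G ^ i)) = v (φ (A j)) * exp (j * m) ∧
      ∀ i < e, v (φ (A i)) * exp (i * m) ≤ v (φ (∑ i ∈ Finset.range e, A i * G ^ i)) := by
  have hG0 : φ G ≠ 0 := Valuation.ne_zero_of_map_eq_exp hv
  have hterm : ∀ i : ℕ, v (φ (A i * G ^ i)) = v (φ (A i)) * exp (i * m) := by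
    intro i
    rw [map_mul, map_pow, map_mul, map_pow, hv, ← exp_nsmul, nsmul_eq_mul]
  obtain ⟨j, hj, hj0, hsum, hmax⟩ := v.exists_map_sum_eq_of_injOn
    (s := Finset.range e) (x := fun i => φ (A i * G ^ i)) (by
      intro i hi j hj hi0 hj0 hij
      have hAi : A i ≠ 0 := by rintro h0; simp [h0] at hi0
      have hAj : A j ≠ 0 := by rintro h0; simp [h0] at hj0
      obtain ⟨t, ht⟩ := h.exists_eq _ (hA i) hAi
      obtain ⟨s, hs⟩ := h.exists_eq _ (hA j) hAj
      rw [hterm, hterm, ht, hs, ← exp_add, ← exp_add, exp_inj] at hij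
      have hi' := Finset.mem_range.1 hi
      have hj' := Finset.mem_range.1 hj
      have := he ((i : ℤ) - j) (by rw [abs_lt]; omega) ⟨s - t, by linear_combination hij⟩
      omega)
    (by
      obtain ⟨j, hj, hj0⟩ := hne
      refine ⟨j, Finset.mem_range.2 hj, ?_⟩
      rw [map_mul, map_pow]
      exact mul_ne_zero (h.map_ne_zero (hA j) hj0) (pow_ne_zero _ hG0))
  refine ⟨j, Finset.mem_range.1 hj, ?_, ?_, ?_⟩
  · rintro h0
    simp [h0] at hj0
  · rw [map_sum, hsum, hterm]
  · intro i hi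
    rw [map_sum, ← hterm]
    exact hmax i (Finset.mem_range.2 hi)

theorem _root_.Int.eq_zero_of_dvd_mul_of_abs_lt {d m j : ℤ} (hd : 0 < d)
    (hj : |j| < (d / (Int.gcd d m : ℤ)).toNat) (h : d ∣ j * m) : j = 0 := by
  have hg : 0 < (Int.gcd d m : ℤ) := by
    exact_mod_cast Int.gcd_pos_of_ne_zero_left m hd.ne'
  have hdiv : d / (Int.gcd d m : ℤ) ∣ j := by
    refine Int.dvd_of_dvd_mul_right_of_gcd_one (b := m / (Int.gcd d m : ℤ)) ?_ ?_
    · obtain ⟨c, hc⟩ := h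
      refine ⟨c, ?_⟩
      obtain ⟨d', hd'⟩ := Int.gcd_dvd_left (a := d) (b := m)
      obtain ⟨m', hm'⟩ := Int.gcd_dvd_right (a := d) (b := m)
      set q : ℤ := (Int.gcd d m : ℤ)
      have h1 : d / q = d' := by rw [hd']; exact Int.mul_ediv_cancel_left _ hg.ne'
      have h2 : m / q = m' := by rw [hm']; exact Int.mul_ediv_cancel_left _ hg.ne'
      rw [h1, h2]
      apply mul_left_cancel₀ hg.ne'
      linear_combination hc - j * hm' + c * hd'
    · exact Int.gcd_div_gcd_div_gcd (by exact_mod_cast hg)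
  refine Int.eq_zero_of_abs_lt_dvd hdiv (hj.trans_le ?_)
  rw [Int.toNat_of_nonneg (Int.ediv_nonneg hd.le hg.le)]

theorem step (h : IsStage v φ k d) (hd : 0 < d) {G : F[X]} {m : ℤ} (hG : G.Monic)
    (hGk : G.natDegree = k) (hv : v (φ G) = exp m) :
    IsStage v φ (k * (d / (Int.gcd d m : ℤ)).toNat) (Int.gcd d m : ℤ) := by
  have hg : 0 < (Int.gcd d m : ℤ) := by
    exact_mod_cast Int.gcd_pos_of_ne_zero_left m hd.ne'
  have hgd : (Int.gcd d m : ℤ) ∣ d := Int.gcd_dvd_left ..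
  have hgm : (Int.gcd d m : ℤ) ∣ m := Int.gcd_dvd_right ..
  set e := (d / (Int.gcd d m : ℤ)).toNat with he
  have hecast : (e : ℤ) = d / (Int.gcd d m : ℤ) :=
    Int.toNat_of_nonneg (Int.ediv_nonneg hd.le hg.le)
  have hege : (e : ℤ) * (Int.gcd d m : ℤ) = d := by
    rw [hecast]; exact Int.ediv_mul_cancel hgd
  have hepos : 0 < (e : ℤ) := by
    by_contra! hcon
    nlinarith
  constructor
  · intro Q hQ hQ0
    obtain ⟨A, hA, rfl⟩ := hG.exists_adic_expansion hGk e Q hQ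
    have hne : ∃ j < e, A j ≠ 0 := by
      by_contra! hcon
      exact hQ0 (Finset.sum_eq_zero fun j hj => by rw [hcon j (Finset.mem_range.1 hj), zero_mul])
    obtain ⟨j, hj, hj0, hsum, -⟩ := h.exists_map_sum hv
      (fun j => Int.eq_zero_of_dvd_mul_of_abs_lt hd) hA hne
    obtain ⟨t, ht⟩ := h.exists_eq _ (hA j) hj0
    obtain ⟨c, hc⟩ : (Int.gcd d m : ℤ) ∣ d * t + j * m :=
      dvd_add (hgd.mul_right t) (hgm.mul_left _)
    exact ⟨c, by rw [hsum, ht, ← exp_add, hc]⟩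
  · intro t
    have hbez : (Int.gcd d m : ℤ) = d * Int.gcdA d m + m * Int.gcdB d m := Int.gcd_eq_gcd_ab d m
    set b := Int.gcdB d m * t
    obtain ⟨m', hm'⟩ := hgm
    have hbmod := Int.emod_add_mul_ediv b e
    have hb0 := Int.emod_nonneg b hepos.ne'
    have hb1 := Int.emod_lt_of_pos b hepos
    obtain ⟨j, hj⟩ := Int.eq_ofNat_of_zero_le hb0
    -- The Bézout exponent `b` of `G` is reduced mod `e`; since `e * m = d * m'`, the discarded
    -- multiple of `e` is absorbed into the value of `A`.
    obtain ⟨A, hA, hAv⟩ := h.exists_poly (Int.gcdA d m * t + m' * (b / e))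
    refine ⟨A * G ^ j, ?_, ?_⟩
    · refine (degree_mul_lt_of_lt_of_natDegree_le hA
        (natDegree_pow_le_of_le j hGk.le)).trans_le ?_
      have : j + 1 ≤ e := by omega
      exact_mod_cast (by nlinarith : k + j * k ≤ k * e)
    · rw [map_mul, map_pow, map_mul, map_pow, hv, hAv, ← exp_nsmul, ← exp_add, nsmul_eq_mul]
      congr 1
      rw [hj] at hbmod
      have hm'' : m * e = d * m' := by
        rw [← hege]; nth_rewrite 1 [hm']; ring
      linear_combination (-t) * hbez + m * hbmod - (b / e) * hm''

/-- If `d` divided the least value, some `A` of degree `< k` would have the same value, and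
subtracting a scalar multiple of `A` would lower it. -/
theorem exists_minimal (h : IsStage v φ k d)
    (hres : ∀ a b : E, a ≠ 0 → v a = v b → ∃ c : F, v (a - φ (C c) * b) < v a)
    (hbd : ∃ B : ℤ, ∀ G : F[X], G.Monic → G.natDegree = k → exp B ≤ v (φ G)) :
    ∃ (G : F[X]) (m : ℤ), G.Monic ∧ G.natDegree = k ∧ v (φ G) = exp m ∧ ¬ d ∣ m ∧
      ∀ H : F[X], H.Monic → H.natDegree = k → exp m ≤ v (φ H) := by
  obtain ⟨B, hB⟩ := hbd
  have hexp : ∀ G : F[X], G.Monic → G.natDegree = k → ∃ z : ℤ, v (φ G) = exp z := by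
    intro G hG hGk
    refine ⟨log (v (φ G)), (exp_log ?_).symm⟩
    exact (lt_of_lt_of_le (by simp [zero_lt_iff]) (hB G hG hGk)).ne'
  obtain ⟨m, ⟨G, hG, hGk, hv⟩, hmin⟩ := Int.exists_least_of_bdd
    (P := fun z => ∃ G : F[X], G.Monic ∧ G.natDegree = k ∧ v (φ G) = exp z)
    ⟨B, by
      rintro z ⟨G, hG, hGk, hv⟩
      simpa [hv] using hB G hG hGk⟩
    (by
      obtain ⟨z, hz⟩ := hexp (X ^ k) (monic_X_pow k) (natDegree_X_pow k)
      exact ⟨z, X ^ k, monic_X_pow k, natDegree_X_pow k, hz⟩)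
  refine ⟨G, m, hG, hGk, hv, ?_, ?_⟩
  · rintro ⟨t, rfl⟩
    obtain ⟨A, hA, hAv⟩ := h.exists_poly t
    obtain ⟨c, hc⟩ := hres (φ G) (φ A) (Valuation.ne_zero_of_map_eq_exp hv) (by rw [hv, hAv])
    have hd : (C c * A).degree < G.degree := by
      rw [degree_eq_natDegree hG.ne_zero, hGk, ← smul_eq_C_mul]
      exact (degree_smul_le c A).trans_lt hA
    have hGm : (G - C c * A).Monic := hG.sub_of_left hd
    have hGmk : (G - C c * A).natDegree = k := by
      rw [natDegree_sub_eq_left_of_natDegree_lt, hGk]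
      rcases eq_or_ne (C c * A) 0 with h0 | h0
      · rw [h0, natDegree_zero, hGk]; exact h.pos
      · exact natDegree_lt_natDegree h0 hd
    obtain ⟨z, hz⟩ := hexp _ hGm hGmk
    have h1 := hmin z ⟨_, hGm, hGmk, hz⟩
    rw [← map_mul, ← map_sub, hz, hv, exp_lt_exp] at hc
    omega
  · intro H hH hHk
    obtain ⟨z, hz⟩ := hexp H hH hHk
    rw [hz, exp_le_exp]
    exact hmin z ⟨H, hH, hHk, hz⟩

/-- Descent: an approximate root of a polynomial of small value has the minimal value. -/
theorem exists_approxRoot_map_eq [CharZero F] (hnat : ∀ q : ℕ, q ≠ 0 → v (q : E) = 1)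
    (h : IsStage v φ k d) {G : F[X]} {m : ℤ} (hG : G.Monic) (hGk : G.natDegree = k)
    (hv : v (φ G) = exp m) (hdm : ¬ d ∣ m) {e : ℕ}
    (he : ∀ j : ℤ, |j| < (e + 1 : ℕ) → d ∣ j * m → j = 0) {T : F[X]} (hT : T.Monic)
    (hTk : T.natDegree = k * (e + 1)) (hTv : v (φ T) ≤ exp ((e + 1 : ℕ) * m)) :
    ∃ H : F[X], H.Monic ∧ H.natDegree = k ∧ v (φ H) = exp m ∧
      (T - H ^ (e + 1)).degree < (k * e : ℕ) := by
  have hu : ((e : F) + 1) * ((e : F) + 1)⁻¹ = 1 :=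
    mul_inv_cancel₀ (by exact_mod_cast e.succ_ne_zero)
  refine exists_approxRoot (p := fun G => v (φ G) = exp m) hu hT hTk ?_ hG hGk hv
  intro G hG hGk hv A hA hrem
  obtain ⟨A', hA', hsum⟩ := hG.exists_adic_expansion hGk e _ hrem
  rcases eq_or_ne A 0 with rfl | hA0
  · simpa using hv
  have hpow : ∀ n : ℕ, v (φ (G ^ n)) = exp (n * m) := by
    intro n
    rw [map_pow, map_pow, hv, ← exp_nsmul, nsmul_eq_mul]
  obtain ⟨-, -, -, -, hmax⟩ := h.exists_map_sum hv he
    (A := fun j => if j = e then A else A' j)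
    (fun j => by split_ifs; exacts [hA, hA' j])
    ⟨e, e.lt_succ_self, by simpa using hA0⟩
  have hsum' : ∑ i ∈ Finset.range (e + 1), (if i = e then A else A' i) * G ^ i =
      T - G ^ (e + 1) := by
    rw [Finset.sum_range_succ, if_pos rfl, Finset.sum_congr rfl (g := fun i => A' i * G ^ i),
      ← hsum, sub_add_cancel]
    intro i hi
    rw [if_neg (Finset.mem_range.1 hi).ne]
  -- The term `A * G ^ e` cannot exceed the whole sum, so `v (φ A) ≤ exp m`; the inequality is
  -- strict because the exponent of `A` is a multiple of `d` and `m` is not.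
  have h1 := hmax e e.lt_succ_self
  rw [hsum', if_pos rfl] at h1
  have h2 : v (φ (T - G ^ (e + 1))) ≤ exp ((e + 1 : ℕ) * m) := by
    rw [map_sub]
    exact v.map_sub_le hTv (hpow (e + 1)).le
  obtain ⟨t, ht⟩ := h.exists_eq A hA hA0
  have h3 : d * t < m := by
    have h4 := h1.trans h2
    rw [ht, ← exp_add, exp_le_exp] at h4
    push_cast at h4
    refine lt_of_le_of_ne (by linarith) ?_
    rintro rfl
    exact hdm ⟨t, rfl⟩
  have h5 : v (φ (C ((e : F) + 1)⁻¹ * A)) = v (φ A) := by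
    have h6 : ((e + 1 : ℕ) : E) * φ (C ((e : F) + 1)⁻¹ * A) = φ A := by
      rw [← map_natCast φ, ← map_mul, ← mul_assoc, ← C_eq_natCast, ← C_mul]
      push_cast
      rw [hu, C_1, one_mul]
    rw [← h6, map_mul v, hnat (e + 1) e.succ_ne_zero, one_mul]
  rw [map_add, ← hv]
  refine v.map_add_eq_of_lt_left ?_
  rw [h5, ht, hv, exp_lt_exp]
  exact h3

end Polynomial.IsStage

end Stage

/-! ### Descent of key polynomials to coefficients in `R`. -/

section Stage

variable {R F E : Type*} [CommRing R] [Field F] [Field E] [CharZero F] [Algebra R F]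
  {v : Valuation E ℤᵐ⁰} {φ : F[X] →+* E} {k : ℕ} {d : ℤ}

/-- The approximate root can be built over `R` already, and over `F` it is unique. -/
theorem Polynomial.eq_map_of_degree_sub_pow_lt [Nontrivial R]
    (hinj : Function.Injective (algebraMap R F))
    {e : ℕ} (hu : ∃ u : R, ((e : R) + 1) * u = 1) {T : R[X]} (hT : T.Monic)
    (hTk : T.natDegree = k * (e + 1)) {G : F[X]} (hG : G.Monic) (hGk : G.natDegree = k)
    (h : (T.map (algebraMap R F) - G ^ (e + 1)).degree < (k * e : ℕ)) :
    ∃ H : R[X], H.Monic ∧ H.natDegree = k ∧ H.map (algebraMap R F) = G := by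
  obtain ⟨u, hu⟩ := hu
  obtain ⟨H, hH, hHk, -, hHT⟩ := exists_approxRoot (p := fun _ => True) hu hT hTk
    (fun _ _ _ _ _ _ _ => trivial) (monic_X_pow k) (natDegree_X_pow k) trivial
  refine ⟨H, hH, hHk, ?_⟩
  refine (hH.map _).eq_of_degree_pow_sub_pow_lt hG
    (by rw [natDegree_map_eq_of_injective hinj, hHk]) hGk (e := e) ?_
  have : H.map (algebraMap R F) ^ (e + 1) - G ^ (e + 1) =
      (T.map (algebraMap R F) - G ^ (e + 1)) - (T - H ^ (e + 1)).map (algebraMap R F) := by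
    rw [Polynomial.map_sub, Polynomial.map_pow]; ring
  rw [this]
  refine (degree_sub_le _ _).trans_lt (max_lt h ?_)
  exact degree_map_le.trans_lt hHT

/-- Both claims are proved together, from larger `k` to smaller: the first at the next stage
provides the polynomial `T` whose approximate root is the key polynomial over `R`, and the second
provides the polynomial to expand in its powers. -/
theorem Polynomial.IsStage.exists_lift [Nontrivial R]
    (hinj : Function.Injective (algebraMap R F))
    (hunit : ∀ e : ℕ, ∃ u : R, ((e : R) + 1) * u = 1)
    (hnat : ∀ q : ℕ, q ≠ 0 → v (q : E) = 1)
    {P : R[X]} (hP : P.Monic) (hP0 : φ (P.map (algebraMap R F)) = 0)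
    (hres : ∀ a b : E, a ≠ 0 → v a = v b → ∃ c : F, v (a - φ (C c) * b) < v a)
    (hbd : ∀ k < P.natDegree, ∃ B : ℤ, ∀ G : F[X], G.Monic → G.natDegree = k → exp B ≤ v (φ G))
    (h : IsStage v φ k d) (hd : 0 < d) :
    (∀ G : F[X], G.Monic → G.natDegree = k → ∃ H : R[X], H.Monic ∧ H.natDegree = k ∧
      v (φ (H.map (algebraMap R F))) ≤ v (φ G)) ∧
    (∀ (H : R[X]) (t : ℤ), v (φ (H.map (algebraMap R F))) = exp (d * t) →
      ∃ H₀ : R[X], H₀.degree < k ∧ v (φ (H₀.map (algebraMap R F))) = exp (d * t)) := by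
  obtain ⟨c, hc⟩ : ∃ c, c = P.natDegree - k := ⟨_, rfl⟩
  induction c using Nat.strong_induction_on generalizing k d with
  | _ c ih =>
  subst hc
  have hkN : k ≤ P.natDegree := by
    by_contra! hlt
    refine h.map_ne_zero (A := P.map (algebraMap R F)) ?_ (hP.map _).ne_zero hP0
    refine degree_map_le.trans_lt ?_
    rw [degree_eq_natDegree hP.ne_zero]
    exact_mod_cast hlt
  rcases hkN.eq_or_lt with hkN | hkN
  -- At the top degree `P` itself has value `0`, below every other value, and reduction mod `P`
  -- changes no value.
  · refine ⟨fun G _ _ => ⟨P, hP, hkN.symm, by simp [hP0]⟩, fun H t ht => ?_⟩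
    refine ⟨H %ₘ P, ?_, ?_⟩
    · rw [hkN, ← degree_eq_natDegree hP.ne_zero]
      exact degree_modByMonic_lt _ hP
    · rw [← ht]
      conv_rhs => rw [← modByMonic_add_div H P]
      rw [Polynomial.map_add, Polynomial.map_mul, map_add φ, map_mul φ, hP0, zero_mul, add_zero]
  obtain ⟨G, m, hG, hGk, hv, hdm, hmin⟩ := h.exists_minimal hres (hbd k hkN)
  have hg : 0 < (Int.gcd d m : ℤ) := by exact_mod_cast Int.gcd_pos_of_ne_zero_left m hd.ne'
  have hgd : (Int.gcd d m : ℤ) ∣ d := Int.gcd_dvd_left ..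
  have hgm : (Int.gcd d m : ℤ) ∣ m := Int.gcd_dvd_right ..
  have hstep := h.step hd hG hGk hv
  have hsmall := fun j : ℤ => Int.eq_zero_of_dvd_mul_of_abs_lt (m := m) (j := j) hd
  set e' := (d / (Int.gcd d m : ℤ)).toNat with he'
  have hege : (e' : ℤ) * (Int.gcd d m : ℤ) = d := by
    rw [he', Int.toNat_of_nonneg (Int.ediv_nonneg hd.le hg.le)]
    exact Int.ediv_mul_cancel hgd
  clear_value e'
  have he2 : 2 ≤ e' := by
    by_contra! hlt
    interval_cases e'
    · simp at hege; omega
    · simp only [Nat.cast_one, one_mul] at hege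
      rw [hege] at hgm
      exact hdm hgm
  obtain ⟨e, rfl⟩ : ∃ e, e' = e + 1 := ⟨e' - 1, by omega⟩
  have hk := h.pos
  obtain ⟨iha, ihb⟩ := ih _ (by
    have : k < k * (e + 1) := by nlinarith
    omega) hstep hg rfl
  -- The next stage is compared with `G ^ (e + 1)`, which bounds the value of `T` as the approximate
  -- root argument requires.
  obtain ⟨T, hT, hTk, hTv⟩ := iha (G ^ (e + 1)) (hG.pow _)
    (by rw [hG.natDegree_pow, hGk, mul_comm])
  obtain ⟨H', hH', hH'k, hH'v, hTH'⟩ := h.exists_approxRoot_map_eq hnat hG hGk hv hdm hsmall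
    (hT.map _) (by rw [natDegree_map_eq_of_injective hinj, hTk]) (by
      refine hTv.trans (le_of_eq ?_)
      rw [map_pow, map_pow, hv, ← exp_nsmul, nsmul_eq_mul])
  obtain ⟨H, hH, hHk, rfl⟩ := eq_map_of_degree_sub_pow_lt hinj (hunit e) hT hTk hH' hH'k hTH'
  refine ⟨fun G' hG' hG'k => ⟨H, hH, hHk, hH'v.trans_le (hmin G' hG' hG'k)⟩, fun Q t ht => ?_⟩
  obtain ⟨d', hd'⟩ := hgd
  obtain ⟨Q', hQ', hQ'v⟩ := ihb Q (d' * t) (by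
    rw [ht]; congr 1; nth_rewrite 1 [hd']; ring)
  have hQ'v : v (φ (Q'.map (algebraMap R F))) = exp (d * t) := by
    rw [hQ'v]; congr 1; nth_rewrite 2 [hd']; ring
  obtain ⟨A, hA, rfl⟩ := hH.exists_adic_expansion hHk (e + 1) Q' hQ'
  have hmapsum : (∑ j ∈ Finset.range (e + 1), A j * H ^ j).map (algebraMap R F) =
      ∑ j ∈ Finset.range (e + 1), (A j).map (algebraMap R F) * H.map (algebraMap R F) ^ j := by
    simp only [Polynomial.map_sum, Polynomial.map_mul, Polynomial.map_pow]
  rw [hmapsum] at hQ'v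
  have hA' : ∀ j, ((A j).map (algebraMap R F)).degree < k := fun j =>
    degree_map_le.trans_lt (hA j)
  obtain ⟨j, hj, hj0, hsum, -⟩ := h.exists_map_sum hH'v hsmall hA' (by
    by_contra! hcon
    rw [Finset.sum_eq_zero fun j hj => by rw [hcon j (Finset.mem_range.1 hj), zero_mul],
      map_zero, map_zero] at hQ'v
    exact exp_ne_zero hQ'v.symm)
  obtain ⟨s, hs⟩ := h.exists_eq _ (hA' j) hj0
  rw [hQ'v] at hsum
  -- The total value and that of `A j` are both multiples of `d`, hence so is `j * m`, with `j < e +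
  -- 1`.
  have hj0 : (j : ℤ) = 0 := by
    refine hsmall j (by rw [abs_lt]; omega) ?_
    rw [hs, ← exp_add, exp_inj] at hsum
    exact ⟨t - s, by linear_combination -hsum⟩
  exact ⟨A j, hA j, by rw [hsum, hj0, zero_mul, exp_zero, mul_one]⟩

theorem Polynomial.IsStage.exists_eq_add_mul [IsDomain R]
    (hinj : Function.Injective (algebraMap R F))
    (hunit : ∀ e : ℕ, ∃ u : R, ((e : R) + 1) * u = 1)
    (hnat : ∀ q : ℕ, q ≠ 0 → v (q : E) = 1)
    {P : R[X]} (hP : P.Monic) (hP0 : φ (P.map (algebraMap R F)) = 0)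
    (hres : ∀ a b : E, a ≠ 0 → v a = v b → ∃ c : F, v (a - φ (C c) * b) < v a)
    (hbd : ∀ k < P.natDegree, ∃ B : ℤ, ∀ G : F[X], G.Monic → G.natDegree = k → exp B ≤ v (φ G))
    (h : IsStage v φ 1 d) (hd : 0 < d) {m : ℤ} (hm : v (φ X) = exp m)
    {H : R[X]} {t : ℤ} (hH : v (φ (H.map (algebraMap R F))) = exp (Int.gcd d m * t)) :
    ∃ (a : R) (j : ℕ), v (φ (C (algebraMap R F a))) * exp (j * m) = exp (Int.gcd d m * t) := by
  have hg : 0 < (Int.gcd d m : ℤ) := by exact_mod_cast Int.gcd_pos_of_ne_zero_left m hd.ne'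
  have hstep := h.step hd monic_X natDegree_X hm
  obtain ⟨-, hb⟩ := hstep.exists_lift hinj hunit hnat hP hP0 hres hbd hg
  obtain ⟨Q, hQ, hQv⟩ := hb H t hH
  obtain ⟨A, hA, rfl⟩ := monic_X.exists_adic_expansion natDegree_X _ Q hQ
  have hA' : ∀ j, ((A j).map (algebraMap R F)).degree < (1 : ℕ) := fun j =>
    degree_map_le.trans_lt (hA j)
  simp only [Polynomial.map_sum, Polynomial.map_mul, Polynomial.map_pow, map_X] at hQv
  obtain ⟨j, hj, hj0, hsum, -⟩ := h.exists_map_sum hm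
    (fun j => Int.eq_zero_of_dvd_mul_of_abs_lt hd) hA' (by
    by_contra! hcon
    rw [Finset.sum_eq_zero fun j hj => by rw [hcon j (Finset.mem_range.1 hj), zero_mul],
      map_zero, map_zero] at hQv
    exact exp_ne_zero hQv.symm)
  have hAj : A j = C ((A j).coeff 0) :=
    eq_C_of_degree_le_zero (Nat.WithBot.lt_one_iff_le_zero.1 (by simpa using hA j))
  rw [hAj, map_C] at hsum
  exact ⟨(A j).coeff 0, j, by rw [← hsum, hQv]⟩

end Stage

/-! ### Lower bounds on values, and the integral minimal polynomial. -/

section Abstract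

variable {F E : Type*} [Field F] [Field E]

/-- A linear functional that kills polynomials of degree `< k` but not `X ^ k` is constant on monic
polynomials of degree `k`, and it is bounded with respect to `v` because the `w i` are orthogonal.
-/
theorem Polynomial.exists_le_valuation_of_monic {v : Valuation E ℤᵐ⁰} {σ : F →+* E} {φ : F[X] →+* E}
    (hφ : ∀ a, φ (C a) = σ a) {ι : Type*} [Fintype ι] {w : ι → E} (hw0 : ∀ i, w i ≠ 0)
    (hw : ∀ (u : ι → F) (i : ι), v (σ (u i) * w i) ≤ v (∑ j, σ (u j) * w j))
    (hcoord : ∀ j : ℕ, ∃ b : ι → F, φ (X ^ j) = ∑ i, σ (b i) * w i) {k : ℕ}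
    (hinj : ∀ Q : F[X], Q ≠ 0 → Q.natDegree ≤ k → φ Q ≠ 0) :
    ∃ B : ℤ, ∀ G : F[X], G.Monic → G.natDegree = k → exp B ≤ v (φ G) := by
  classical
  choose b hb using hcoord
  set c : F[X] →ₗ[F] (ι → F) := (basisMonomials F).constr F b
  have hcX : ∀ j, c (X ^ j) = b j := by
    intro j
    have := (basisMonomials F).constr_basis F b j
    simpa only [coe_basisMonomials, monomial_one_right_eq_X_pow] using this
  have hc : ∀ Q, φ Q = ∑ i, σ (c Q i) * w i := by
    intro Q
    induction Q using Polynomial.induction_on' with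
    | add p q hp hq => simp only [map_add, hp, hq, Pi.add_apply, add_mul, Finset.sum_add_distrib]
    | monomial j a =>
      rw [← C_mul_X_pow_eq_monomial, map_mul, hφ, hb, ← smul_eq_C_mul, map_smul, hcX,
        Finset.mul_sum]
      simp [mul_assoc]
  have hnot : c (X ^ k) ∉ (degreeLT F k).map c := by
    rintro ⟨Q, hQ, hQc⟩
    have hQ' : Q.degree < k := mem_degreeLT.1 hQ
    have hlt : Q.degree < ((X : F[X]) ^ k).degree := by simpa using hQ'
    have hm : ((X : F[X]) ^ k - Q).Monic := (monic_X_pow k).sub_of_left hlt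
    refine hinj (X ^ k - Q) hm.ne_zero ?_ ?_
    · refine natDegree_le_of_degree_le ((degree_sub_le _ _).trans (max_le ?_ hQ'.le))
      simp
    · rw [map_sub, hc, hc Q, hQc, sub_self]
  obtain ⟨l, hl, hker⟩ := Submodule.exists_le_ker_of_notMem hnot
  -- Inserting `1` ensures `M ≠ 0`, so that division by `M` is legitimate.
  obtain ⟨M, hM⟩ := Finset.exists_le (insert 1
    (Finset.univ.image fun i => v (σ (l (Pi.single i 1))) / v (w i)))
  have hM0 : M ≠ 0 := (lt_of_lt_of_le zero_lt_one (hM 1 (Finset.mem_insert_self _ _))).ne'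
  have hl0 : v (σ (l (c (X ^ k)))) ≠ 0 := by simpa using hl
  refine ⟨log (v (σ (l (c (X ^ k)))) / M), fun G hG hGk => ?_⟩
  rw [exp_log (div_ne_zero hl0 hM0), div_le_iff₀ (zero_lt_iff.2 hM0)]
  have hlG : l (c G) = l (c (X ^ k)) := by
    rw [← sub_eq_zero, ← map_sub, ← map_sub]
    refine hker ⟨_, ?_, rfl⟩
    refine mem_degreeLT.2 ?_
    have h1 := degree_sub_lt_left (p := G) (q := X ^ k)
      (by rw [degree_X_pow, degree_eq_natDegree hG.ne_zero, hGk]) hG.ne_zero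
      (by rw [hG.leadingCoeff, (monic_X_pow k).leadingCoeff])
    rwa [degree_eq_natDegree hG.ne_zero, hGk] at h1
  rw [← hlG, l.pi_apply_eq_sum_univ (c G), map_sum]
  refine v.map_sum_le fun i _ => ?_
  have h1 := hw (c G) i
  rw [← hc] at h1
  have h2 := hM _ (Finset.mem_insert_of_mem (Finset.mem_image_of_mem _ (Finset.mem_univ i)))
  have hwi : 0 < v (w i) := by simpa [zero_lt_iff] using hw0 i
  have h3 : (fun j => if i = j then (1 : F) else 0) = Pi.single i 1 := by
    ext j; simp [Pi.single_apply, eq_comm]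
  rw [div_le_iff₀ hwi] at h2
  rw [h3, smul_eq_mul, map_mul, map_mul]
  refine le_of_mul_le_mul_right ?_ hwi
  calc v (σ (c G i)) * v (σ (l (Pi.single i 1))) * v (w i)
      = v (σ (c G i) * w i) * v (σ (l (Pi.single i 1))) := by rw [map_mul, mul_right_comm]
    _ ≤ v (φ G) * (M * v (w i)) := mul_le_mul' h1 h2
    _ = v (φ G) * M * v (w i) := (mul_assoc _ _ _).symm

theorem Polynomial.exists_monic_eval₂_eq_zero_of_isIntegralElem {R : Type*} [CommRing R] [IsDomain R]
    [IsIntegrallyClosed R] [Algebra R F] [IsFractionRing R F] (σ : F →+* E) {g : E}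
    (hg : (σ.comp (algebraMap R F)).IsIntegralElem g) :
    ∃ P : R[X], P.Monic ∧ (P.map (algebraMap R F)).eval₂ σ g = 0 ∧
      ∀ Q : F[X], Q ≠ 0 → Q.natDegree < P.natDegree → Q.eval₂ σ g ≠ 0 := by
  let : Algebra F E := σ.toAlgebra
  let : Algebra R E := (σ.comp (algebraMap R F)).toAlgebra
  have : IsScalarTower R F E := IsScalarTower.of_algebraMap_eq fun _ => rfl
  have hint : IsIntegral R g := hg
  have hmin := minpoly.isIntegrallyClosed_eq_field_fractions' F hint
  refine ⟨minpoly R g, minpoly.monic hint, ?_, fun Q hQ hlt h0 => ?_⟩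
  · rw [← hmin]
    exact minpoly.aeval F g
  · refine absurd (natDegree_le_natDegree (minpoly.degree_le_of_ne_zero F g hQ h0)) (not_le.2 ?_)
    rwa [hmin, (minpoly.monic hint).natDegree_map]

end Abstract

/-! ### The degree valuation on `K(z)` and the embedding `x ↦ f`. -/

section RationalFunctions

variable {K : Type*} [Field K]

theorem Polynomial.exists_comp_expansion {f : K[X]} {n : ℕ} (hn : 0 < n) (hf : f.natDegree = n)
    (p : K[X]) : ∃ b : Fin n → K[X], p = ∑ i, (b i).comp f * X ^ (i : ℕ) := by
  have hf0 : f ≠ 0 := by rintro rfl; simp at hf; omega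
  have hfd : f.degree = n := by rw [degree_eq_natDegree hf0, hf]
  induction hd : p.natDegree using Nat.strong_induction_on generalizing p with
  | _ N ih =>
  subst hd
  have hmod : p % f = ∑ i : Fin n, C ((p % f).coeff i) * X ^ (i : ℕ) := by
    rw [Fin.sum_univ_eq_sum_range (fun i => C ((p % f).coeff i) * X ^ i) n]
    refine as_sum_range_C_mul_X_pow' _ ?_
    rcases eq_or_ne (p % f) 0 with h0 | h0
    · rw [h0, natDegree_zero]; exact hn
    · exact hf ▸ natDegree_lt_natDegree h0 (degree_mod_lt p hf0)
  rcases eq_or_ne p 0 with rfl | hp0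
  · exact ⟨0, by simp⟩
  by_cases hlt : p.natDegree < n
  · refine ⟨fun i => C (p.coeff i), ?_⟩
    simp only [C_comp]
    rw [Fin.sum_univ_eq_sum_range (fun i => C (p.coeff i) * X ^ i) n]
    exact as_sum_range_C_mul_X_pow' _ hlt
  · obtain ⟨b, hb⟩ := ih (p / f).natDegree (by
      rcases eq_or_ne (p / f) 0 with h0 | h0
      · rw [h0, natDegree_zero]; omega
      · exact natDegree_lt_natDegree h0
          (degree_div_lt hp0 (by rw [hfd]; exact_mod_cast hn))) (p / f) rfl
    refine ⟨fun i => X * b i + C ((p % f).coeff i), ?_⟩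
    conv_lhs => rw [← EuclideanDomain.div_add_mod p f, hb, hmod]
    simp only [add_comp, mul_comp, X_comp, C_comp, add_mul, Finset.sum_add_distrib,
      Finset.mul_sum, mul_assoc]

theorem Polynomial.isIntegralElem_compRingHom {f : K[X]} (hf : 0 < f.natDegree) (g : K[X]) :
    (compRingHom f).IsIntegralElem g := by
  have hf0 : f ≠ 0 := by rintro rfl; simp at hf
  have hC : ∀ a : K, (compRingHom f).IsIntegralElem (C a) := fun a => by
    have := (compRingHom f).isIntegralElem_map (x := C a)
    simpa using this
  have hX : (compRingHom f).IsIntegralElem (X : K[X]) := by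
    -- The indeterminate `z` is a root of `f(T) - x`, made monic, once `x` is sent to `f`.
    refine ⟨(C (f.leadingCoeff⁻¹) * f).map C - C (C f.leadingCoeff⁻¹ * X), ?_, ?_⟩
    · have hm : (C (f.leadingCoeff⁻¹) * f).Monic := by
        rw [mul_comm]; exact monic_mul_leadingCoeff_inv hf0
      refine (hm.map C).sub_of_left (degree_C_le.trans_lt ?_)
      rw [degree_map, degree_C_mul (by simpa using hf0)]
      exact natDegree_pos_iff_degree_pos.1 hf
    · rw [eval₂_sub, eval₂_map, eval₂_C]
      have : (compRingHom f).comp C = C := by ext; simp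
      rw [this, eval₂_mul, eval₂_C, eval₂_C_X]
      simp
  induction g using Polynomial.induction_on' with
  | add p q hp hq => exact hp.add _ hq
  | monomial j a =>
    rw [← C_mul_X_pow_eq_monomial]
    refine RingHom.IsIntegralElem.mul _ (hC a) ?_
    induction j with
    | zero => simpa using hC 1
    | succ j ih => rw [pow_succ]; exact RingHom.IsIntegralElem.mul _ ih hX

namespace RatFunc

theorem exists_ringHom_comp {f : K[X]} (hf : 0 < f.natDegree) :
    ∃ σ : RatFunc K →+* RatFunc K,
      ∀ p : K[X], σ (algebraMap K[X] (RatFunc K) p) = algebraMap K[X] (RatFunc K) (p.comp f) := by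
  have hinj : Function.Injective ((algebraMap K[X] (RatFunc K)).comp (compRingHom f)) := by
    refine (algebraMap_injective K).comp ?_
    rw [injective_iff_map_eq_zero]
    intro p hp
    rw [coe_compRingHom_apply, comp_eq_zero_iff] at hp
    rcases hp with h | ⟨-, h⟩
    · exact h
    · rw [h, natDegree_C] at hf; omega
  exact ⟨IsFractionRing.lift hinj, fun p => IsFractionRing.lift_algebraMap hinj p⟩

variable [DecidableEq (RatFunc K)]

theorem inftyValuation_algebraMap {p : K[X]} (hp : p ≠ 0) :
    inftyValuation K (algebraMap K[X] (RatFunc K) p) = exp (p.natDegree : ℤ) :=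
  inftyValuation.polynomial K hp

theorem exists_inftyValuation_comp_eq {f : K[X]} {σ : RatFunc K →+* RatFunc K}
    (hσ : ∀ p : K[X], σ (algebraMap K[X] (RatFunc K) p) = algebraMap K[X] (RatFunc K) (p.comp f))
    {a : RatFunc K} (ha : a ≠ 0) :
    ∃ t : ℤ, inftyValuation K (σ a) = exp (f.natDegree * t) := by
  have hpoly : ∀ p : K[X], p ≠ 0 →
      inftyValuation K (σ (algebraMap K[X] (RatFunc K) p)) = exp (f.natDegree * p.natDegree : ℤ) := by
    intro p hp
    have hne : p.comp f ≠ 0 := by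
      intro h0
      have : σ (algebraMap K[X] (RatFunc K) p) = 0 := by rw [hσ, h0, map_zero]
      rw [map_eq_zero, map_eq_zero_iff _ (algebraMap_injective K)] at this
      exact hp this
    rw [hσ, inftyValuation_algebraMap hne, natDegree_comp, mul_comm]
    push_cast; rfl
  refine ⟨a.num.natDegree - a.denom.natDegree, ?_⟩
  conv_lhs => rw [← num_div_denom a]
  rw [map_div₀, map_div₀, hpoly _ (num_ne_zero ha), hpoly _ a.denom_ne_zero, ← exp_sub, mul_sub]

/-- The residue field at infinity is `K`: the ratio of leading coefficients cancels the top degree.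
-/
theorem exists_inftyValuation_sub_lt {a b : RatFunc K} (ha : a ≠ 0)
    (hab : inftyValuation K a = inftyValuation K b) :
    ∃ c : K, inftyValuation K (a - algebraMap K[X] (RatFunc K) (Polynomial.C c) * b) < inftyValuation K a := by
  have hva : inftyValuation K a ≠ 0 := by simpa using ha
  have hb : b ≠ 0 := by
    rintro rfl
    exact hva (by rw [hab, map_zero])
  have hq : a / b ≠ 0 := div_ne_zero ha hb
  have hnum := num_ne_zero hq
  have hden := (a / b).denom_ne_zero
  have hdeg : (a / b).num.natDegree = (a / b).denom.natDegree := by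
    have h1 : inftyValuation K (a / b) = 1 := by rw [map_div₀, ← hab, div_self hva]
    rw [← num_div_denom (a / b), map_div₀, inftyValuation_algebraMap hnum,
      inftyValuation_algebraMap hden, ← exp_sub, ← exp_zero, exp_inj] at h1
    omega
  set p := (a / b).num
  set q := (a / b).denom
  set c := p.leadingCoeff / q.leadingCoeff with hc
  have hc0 : c ≠ 0 := by simp [hc, hnum, hden]
  refine ⟨c, ?_⟩
  have hval : inftyValuation K (algebraMap K[X] (RatFunc K) (p - Polynomial.C c * q)) <
      exp (q.natDegree : ℤ) := by
    rcases eq_or_ne (p - Polynomial.C c * q) 0 with h0 | h0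
    · rw [h0, map_zero, map_zero]; exact zero_lt_iff.2 exp_ne_zero
    · rw [inftyValuation_algebraMap h0, exp_lt_exp]
      have h1 : (p - Polynomial.C c * q).degree < p.degree := by
        refine degree_sub_lt_left ?_ hnum ?_
        · rw [degree_C_mul hc0, degree_eq_natDegree hnum, degree_eq_natDegree hden, hdeg]
        · rw [leadingCoeff_mul, leadingCoeff_C, hc,
            div_mul_cancel₀ _ (leadingCoeff_ne_zero.2 hden)]
      have := natDegree_lt_natDegree h0 h1
      rw [hdeg] at this
      exact_mod_cast this
  have heq : a - algebraMap K[X] (RatFunc K) (Polynomial.C c) * b =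
      b * (algebraMap K[X] (RatFunc K) (p - Polynomial.C c * q) / algebraMap K[X] (RatFunc K) q) := by
    have hq0 : algebraMap K[X] (RatFunc K) q ≠ 0 := algebraMap_ne_zero hden
    have h1 : algebraMap K[X] (RatFunc K) p / algebraMap K[X] (RatFunc K) q = a / b :=
      num_div_denom (a / b)
    rw [map_sub, map_mul, sub_div, h1, mul_div_assoc, div_self hq0]
    field_simp
  rw [heq, map_mul, map_div₀, inftyValuation_algebraMap hden, hab]
  have hvb : 0 < inftyValuation K b := by rw [← hab]; exact zero_lt_iff.2 hva
  have h2 : inftyValuation K (algebraMap K[X] (RatFunc K) (p - Polynomial.C c * q)) / exp (q.natDegree : ℤ)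
      < 1 := by
    rw [div_lt_one₀ (zero_lt_iff.2 exp_ne_zero)]
    exact hval
  calc _ < inftyValuation K b * 1 := mul_lt_mul_of_pos_left h2 hvb
    _ = _ := mul_one _

end RatFunc

end RationalFunctions

/-! ### Application to `K[f,g]`. -/

section Subalgebra

variable {K : Type*} [Field K]

theorem Polynomial.exists_eval₂_eq_of_mem_adjoin_pair {f g h : K[X]}
    (hh : h ∈ Algebra.adjoin K ({f, g} : Set K[X])) :
    ∃ H : K[X][X], H.eval₂ (compRingHom f) g = h := by
  induction hh using Algebra.adjoin_induction with
  | mem x hx =>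
    rcases hx with rfl | rfl
    · exact ⟨C X, by simp⟩
    · exact ⟨X, by simp⟩
  | algebraMap r => exact ⟨C (C r), by simp⟩
  | add x y _ _ hx hy =>
    obtain ⟨P, rfl⟩ := hx
    obtain ⟨Q, rfl⟩ := hy
    exact ⟨P + Q, by rw [eval₂_add]⟩
  | mul x y _ _ hx hy =>
    obtain ⟨P, rfl⟩ := hx
    obtain ⟨Q, rfl⟩ := hy
    exact ⟨P * Q, by rw [eval₂_mul]⟩

theorem Polynomial.eval₂_map_algebraMap_ratFunc {f : K[X]} {σ : RatFunc K →+* RatFunc K}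
    (hσ : ∀ p : K[X], σ (algebraMap K[X] (RatFunc K) p) = algebraMap K[X] (RatFunc K) (p.comp f))
    (g : K[X]) (H : K[X][X]) :
    (H.map (algebraMap K[X] (RatFunc K))).eval₂ σ (algebraMap K[X] (RatFunc K) g) =
      algebraMap K[X] (RatFunc K) (H.eval₂ (compRingHom f) g) := by
  rw [eval₂_map, hom_eval₂]
  congr 1
  exact RingHom.ext hσ

/-- The powers `z ^ i` with `i < n` have degrees distinct mod `n`, while values on `K(f)` are
multiples of `n`; so they are orthogonal over `K(f)`. -/
theorem RatFunc.inftyValuation_le_sum_comp_mul_X_pow [DecidableEq (RatFunc K)] {f : K[X]} {n : ℕ}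
    (hf : f.natDegree = n) {σ : RatFunc K →+* RatFunc K}
    (hσ : ∀ p : K[X], σ (algebraMap K[X] (RatFunc K) p) = algebraMap K[X] (RatFunc K) (p.comp f))
    (u : Fin n → RatFunc K) (i : Fin n) :
    inftyValuation K (σ (u i) * algebraMap K[X] (RatFunc K) (Polynomial.X ^ (i : ℕ))) ≤
      inftyValuation K
        (∑ j, σ (u j) * algebraMap K[X] (RatFunc K) (Polynomial.X ^ (j : ℕ))) := by
  rcases eq_or_ne (u i) 0 with h0 | h0
  · rw [h0, map_zero, zero_mul, map_zero]; exact zero_le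
  have hval : ∀ j, u j ≠ 0 → ∃ t : ℤ, inftyValuation K
      (σ (u j) * algebraMap K[X] (RatFunc K) (Polynomial.X ^ (j : ℕ))) = exp (n * t + (j : ℕ)) := by
    intro j hj
    obtain ⟨t, ht⟩ := exists_inftyValuation_comp_eq hσ hj
    refine ⟨t, ?_⟩
    rw [map_mul, ht, inftyValuation_algebraMap (pow_ne_zero _ Polynomial.X_ne_zero),
      natDegree_X_pow, hf, exp_add]
  obtain ⟨-, -, -, -, hmax⟩ := (inftyValuation K).exists_map_sum_eq_of_injOn
    (s := Finset.univ)
    (x := fun j : Fin n => σ (u j) * algebraMap K[X] (RatFunc K) (Polynomial.X ^ (j : ℕ))) (by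
      intro j _ l _ hj hl hjl
      obtain ⟨t, ht⟩ := hval j (by rintro h; simp [h] at hj)
      obtain ⟨s, hs⟩ := hval l (by rintro h; simp [h] at hl)
      rw [ht, hs, exp_inj] at hjl
      have hj' := j.2
      have hl' := l.2
      have := Int.eq_zero_of_abs_lt_dvd (m := n) (x := (j : ℕ) - (l : ℕ))
        ⟨s - t, by linear_combination hjl⟩ (by rw [abs_lt]; omega)
      exact Fin.ext (by omega))
    ⟨i, Finset.mem_univ i, mul_ne_zero (by simpa using h0)
      (algebraMap_ne_zero (pow_ne_zero _ Polynomial.X_ne_zero))⟩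
  exact hmax i (Finset.mem_univ i)

theorem Polynomial.isStage_one_inftyValuation [DecidableEq (RatFunc K)] {f : K[X]}
    (hf : 0 < f.natDegree) {σ : RatFunc K →+* RatFunc K}
    (hσ : ∀ p : K[X], σ (algebraMap K[X] (RatFunc K) p) = algebraMap K[X] (RatFunc K) (p.comp f))
    (g : RatFunc K) :
    IsStage (RatFunc.inftyValuation K) (eval₂RingHom σ g) 1 f.natDegree := by
  constructor
  · intro A hA hA0
    obtain ⟨a, rfl⟩ : ∃ a, A = C a :=
      ⟨_, eq_C_of_degree_le_zero (Nat.WithBot.lt_one_iff_le_zero.1 (by simpa using hA))⟩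
    rw [coe_eval₂RingHom, eval₂_C]
    exact RatFunc.exists_inftyValuation_comp_eq hσ (by simpa using hA0)
  · intro t
    have hf0 : f ≠ 0 := by rintro rfl; simp at hf
    refine ⟨C (algebraMap K[X] (RatFunc K) X ^ t), degree_C_le.trans_lt (by simp), ?_⟩
    rw [coe_eval₂RingHom, eval₂_C, map_zpow₀, hσ, X_comp, map_zpow₀,
      RatFunc.inftyValuation_algebraMap hf0, ← exp_zsmul, smul_eq_mul, mul_comm]

/-- If `K[f, g]` has an element of degree `gcd (deg f) (deg g)`, this degree lies in the numerical
semigroup generated by `deg f` and `deg g`. -/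
theorem Polynomial.exists_gcd_natDegree_eq_add_of_mem_adjoin_pair [CharZero K] {f g h : K[X]}
    (hf : 0 < f.natDegree) (hg : g ≠ 0) (hh : h ∈ Algebra.adjoin K ({f, g} : Set K[X]))
    (hh0 : h ≠ 0) (hd : h.natDegree = Nat.gcd f.natDegree g.natDegree) :
    ∃ i j : ℕ, i * f.natDegree + j * g.natDegree = Nat.gcd f.natDegree g.natDegree := by
  classical
  obtain ⟨σ, hσ⟩ := RatFunc.exists_ringHom_comp hf
  obtain ⟨H, rfl⟩ := exists_eval₂_eq_of_mem_adjoin_pair hh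
  have hinj := RatFunc.algebraMap_injective K
  have hmap := eval₂_map_algebraMap_ratFunc hσ g
  obtain ⟨P, hP, hP0, hPmin⟩ := exists_monic_eval₂_eq_zero_of_isIntegralElem (R := K[X]) σ
    (g := algebraMap K[X] (RatFunc K) g) (by
      obtain ⟨Q, hQ, hQ0⟩ := isIntegralElem_compRingHom hf g
      exact ⟨Q, hQ, by rw [← eval₂_map, hmap, hQ0, map_zero]⟩)
  have hX : RatFunc.inftyValuation K (eval₂RingHom σ (algebraMap K[X] (RatFunc K) g) X) =
      exp (g.natDegree : ℤ) := by
    rw [coe_eval₂RingHom, eval₂_X, RatFunc.inftyValuation_algebraMap hg]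
  obtain ⟨a, j, haj⟩ := (isStage_one_inftyValuation hf hσ
      (algebraMap K[X] (RatFunc K) g)).exists_eq_add_mul (R := K[X]) hinj
    (fun e => ⟨C ((e + 1 : K)⁻¹), by
      rw [← C_eq_natCast, ← C_1, ← C_add, ← C_mul,
        mul_inv_cancel₀ (by exact_mod_cast e.succ_ne_zero)]⟩)
    (fun q hq => by
      rw [← map_natCast (algebraMap K[X] (RatFunc K)),
        RatFunc.inftyValuation_algebraMap (by exact_mod_cast hq), natDegree_natCast,
        Nat.cast_zero, exp_zero])
    hP hP0
    (fun a b ha hab => by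
      obtain ⟨c, hc⟩ := RatFunc.exists_inftyValuation_sub_lt ha hab
      refine ⟨algebraMap K[X] (RatFunc K) (C c), ?_⟩
      rwa [coe_eval₂RingHom, eval₂_C, hσ, C_comp])
    (fun k hk => by
      refine exists_le_valuation_of_monic (σ := σ)
        (w := fun i : Fin f.natDegree => algebraMap K[X] (RatFunc K) (X ^ (i : ℕ)))
        (fun a => by rw [coe_eval₂RingHom, eval₂_C]) 
        (fun i => RatFunc.algebraMap_ne_zero (pow_ne_zero _ X_ne_zero))
        (RatFunc.inftyValuation_le_sum_comp_mul_X_pow rfl hσ) (fun j => ?_)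
        (fun Q hQ hQk => hPmin Q hQ (hQk.trans_lt hk))
      obtain ⟨b, hb⟩ := exists_comp_expansion hf rfl (g ^ j)
      refine ⟨fun i => algebraMap K[X] (RatFunc K) (b i), ?_⟩
      rw [map_pow, coe_eval₂RingHom, eval₂_X, ← map_pow, hb, map_sum]
      simp only [map_mul, hσ])
    (by exact_mod_cast hf) hX (H := H) (t := 1) (by
      rw [coe_eval₂RingHom, hmap, RatFunc.inftyValuation_algebraMap hh0, hd, mul_one,
        Int.gcd_natCast_natCast])
  have ha : a.comp f ≠ 0 := by
    rintro h0
    rw [coe_eval₂RingHom, eval₂_C, hσ, h0, map_zero, map_zero, zero_mul] at haj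
    exact exp_ne_zero haj.symm
  rw [coe_eval₂RingHom, eval₂_C, hσ, RatFunc.inftyValuation_algebraMap ha, natDegree_comp,
    ← exp_add, exp_inj, mul_one, Int.gcd_natCast_natCast] at haj
  exact ⟨a.natDegree, j, by exact_mod_cast haj⟩

end Subalgebra

theorem mainTheorem5 {K : Type*} [Field K] [CharZero K]
    (f g : Polynomial K) (n m₀ : ℕ)
    (hf : f.degree = (n : WithBot ℕ)) (hg : g.degree = (m₀ : WithBot ℕ))
    (hd : ∃ h ∈ Algebra.adjoin K ({f, g} : Set (Polynomial K)),
      h.degree = ((Nat.gcd n m₀ : ℕ) : WithBot ℕ)) :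
    m₀ ∣ n ∨ n ∣ m₀ := by
  obtain ⟨h, hh, hhd⟩ := hd
  rcases Nat.eq_zero_or_pos n with rfl | hn
  · exact Or.inl (dvd_zero _)
  have hne : ∀ {p : Polynomial K} {k : ℕ}, p.degree = (k : WithBot ℕ) → p ≠ 0 := by
    rintro p k hp rfl
    simp at hp
  have hfn := natDegree_eq_of_degree_eq_some hf
  have hgm := natDegree_eq_of_degree_eq_some hg
  obtain ⟨i, j, hij⟩ := exists_gcd_natDegree_eq_add_of_mem_adjoin_pair (by rwa [hfn]) (hne hg) hh
    (hne hhd) (by rw [natDegree_eq_of_degree_eq_some hhd, hfn, hgm])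
  rw [hfn, hgm] at hij
  have hpos : 0 < Nat.gcd n m₀ := Nat.gcd_pos_of_pos_left _ hn
  rcases Nat.eq_zero_or_pos i with rfl | hi
  · left
    rw [zero_mul, zero_add] at hij
    exact (Dvd.intro_left j hij).trans (Nat.gcd_dvd_left n m₀)
  · right
    have hle : n ≤ Nat.gcd n m₀ := by nlinarith
    have heq : Nat.gcd n m₀ = n := le_antisymm (Nat.gcd_le_left _ hn) hle
    exact heq ▸ Nat.gcd_dvd_right n m₀
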